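/- All graphs are finite, simple and nonempty. For a graph $G=(V,E)$ and $A\subseteq V$ let $\bar A=V\setminus A$ and let $G[A,\bar A]$ be the bipartite graph on $V$ whose edges are the edges of $G$ with one endpoint in $A$ and one in $\bar A$. A branch decomposition of $G$ is a rooted binary tree $T$ whose leaves are in bijection with $V$; a node $t$ of $T$ defines the partition $(A_t,\bar A_t)$ of $V$, where $A_t$ is the set of vertices at the leaves of the subtree rooted in $t$. The mim-width of $T$ is the maximum, over all nodes $t$, of the number of edges of a largest induced matching in $G[A_t,\bar A_t]$, and $\mathsf{mimw}(G)$ is the minimum mim-width of a branch decomposition of $G$. A chord of a cycle is an edge joining two vertices of the cycle that are not adjacent on the cycle; it is odd if their distance along the cycle is odd. A graph is chordal if every cycle of length at least $4$ has a chord; strongly chordal if it is chordal and every even cycle of length at least $6$ has an odd chord; a split graph if its vertex set can be partitioned into a clique and an independent set; chordal bipartite if it is bipartite and every cycle of length at least $6$ has a chord. **Theorem.** There are a constant $c>0$ and an infinite family $(G_i)_{i\in\mathbb N}$ of pairwise non-isomorphic strongly chordal split graphs such that $\mathsf{mimw}(G_i)\ge c\,|V(G_i)|$ for every $i$. Moreover,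 the family can be chosen such that every $G_i$ is obtained from a chordal bipartite graph $H_i$ with colour classes $X_i$ and $Y_i$ and with $\mathsf{mimw}(H_i)\ge c\,|V(H_i)|$ by adding an edge between every two distinct vertices of $Y_i$. In particular, $\sup_i \mathsf{mimw}(G_i)=\infty$, so strongly chordal graphs have unbounded mim-width. -/

import Mathlib

namespace MimWidth

/-- Rooted binary trees whose leaves are labelled by elements of `V`
(every inner node has exactly two children). -/
inductive LeafTree (V : Type*) where
  | leaf (v : V) : LeafTree V
  | node (l r : LeafTree V) : LeafTree V

namespace LeafTree

variable {V : Type*}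

/-- The labels of the leaves of a tree, from left to right. -/
def leaves : LeafTree V → List V
  | leaf v => [v]
  | node l r => l.leaves ++ r.leaves

/-- The subtrees `T_t` rooted in the nodes `t` of `T`, including `T` itself and the leaves. -/
def subtrees : LeafTree V → List (LeafTree V)
  | leaf v => [leaf v]
  | node l r => node l r :: (l.subtrees ++ r.subtrees)

/-- `T` is a branch decomposition of any graph with vertex set `V`: every vertex is the label of
exactly one leaf. -/
def IsBranchDecomposition (T : LeafTree V) : Prop :=
  T.leaves.Nodup ∧ ∀ v : V, v ∈ T.leaves

end LeafTree

variable {V : Type*}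

/-- The mim-value of the partition `A, Aᶜ`: the largest number of edges of an induced matching
in the bipartite graph `G[A, Aᶜ]`. -/
noncomputable def mimValue (G : SimpleGraph V) (A : Set V) : ℕ :=
  sSup {k | ∃ M : (G.between A Aᶜ).Subgraph,
    M.IsMatching ∧ M.IsInduced ∧ M.edgeSet.ncard = k}

/-- The mim-width of a branch decomposition `T` of `G`: the maximum mim-value over all nodes. -/
noncomputable def treeMimWidth (G : SimpleGraph V) (T : LeafTree V) : ℕ :=
  sSup {k | ∃ S ∈ T.subtrees, mimValue G {v | v ∈ S.leaves} = k}

/-- The mim-width of a (finite, nonempty) graph: the minimum over all branch decompositions. -/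
noncomputable def mimWidth (G : SimpleGraph V) : ℕ :=
  sInf {k | ∃ T : LeafTree V, T.IsBranchDecomposition ∧ treeMimWidth G T = k}

/-- The positions `i < j` on the closed walk `C` are the ends of a chord: the two vertices are
adjacent in `G`, but not along `C`. -/
def IsChordAt {G : SimpleGraph V} {v : V} (C : G.Walk v v) (i j : ℕ) : Prop :=
  i < j ∧ j < C.length ∧ G.Adj (C.getVert i) (C.getVert j) ∧
    s(C.getVert i, C.getVert j) ∉ C.edges

/-- `C` has a chord. -/
def HasChord {G : SimpleGraph V} {v : V} (C : G.Walk v v) : Prop :=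
  ∃ i j, IsChordAt C i j

/-- `C` has an odd chord: one whose ends are at odd distance along `C` (for `C` of even length,
both ways around `C` give the same parity). -/
def HasOddChord {G : SimpleGraph V} {v : V} (C : G.Walk v v) : Prop :=
  ∃ i j, IsChordAt C i j ∧ Odd (j - i)

/-- Every cycle of length at least 4 has a chord. -/
def IsChordal (G : SimpleGraph V) : Prop :=
  ∀ (v : V) (C : G.Walk v v), C.IsCycle → 4 ≤ C.length → HasChord C

/-- Chordal, and every even cycle of length at least 6 has an odd chord. -/
def IsStronglyChordal (G : SimpleGraph V) : Prop :=
  IsChordal G ∧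
    ∀ (v : V) (C : G.Walk v v), C.IsCycle → Even C.length → 6 ≤ C.length → HasOddChord C

/-- The vertex set can be partitioned into a clique and an independent set. -/
def IsSplit (G : SimpleGraph V) : Prop :=
  ∃ K : Set V, G.IsClique K ∧ G.IsIndepSet Kᶜ

/-- Bipartite, and every cycle of length at least 6 has a chord. -/
def IsChordalBipartite (G : SimpleGraph V) : Prop :=
  G.IsBipartite ∧
    ∀ (v : V) (C : G.Walk v v), C.IsCycle → 6 ≤ C.length → HasChord C

/-- The graph obtained from `G` by adding an edge between every two distinct vertices of `Y`. -/
def makeClique (G : SimpleGraph V) (Y : Set V) : SimpleGraph V :=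
  G ⊔ SimpleGraph.fromRel (fun u v => u ∈ Y ∧ v ∈ Y)

end MimWidth

namespace MimWidth

open SimpleGraph Finset

/-! Take a bipartite multigraph with classes of size `6 * N` and 48 edges at each left vertex, in
which any two `N`-sets from opposite classes are joined (`exists_joins`, by counting). Replace each
edge by a path left, nearLeft, nearRight, right, and join every left vertex to every right vertex.

A cycle through a subdivision vertex traverses a whole path, whose ends are adjacent; any other
cycle alternates between the completely joined classes. Both give a chord spanning three steps
(`filledSubdivision_exists_adj_add_three`), so the graph is chordal bipartite. Such a chord is odd,
and two consecutive clique vertices on an even cycle of the split graph also force an odd chord;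
hence strong chordality.

For the width, with `N = 3 * k`, every branch decomposition has a cut with at least `2 * N` left
vertices on one side and `2 * N` right vertices on the other. Greedily, `N` disjoint paths cross the
cut, and `k` of them cross at the same one of their three positions. These crossing edges form an
induced matching, before and after the clique is added (`le_mimValue_of_joins`). Since the order is
linear in `k`, so is the mim-width. -/

/-! ### Chords of cycles -/

section Cycles

variable {V : Type*} {G : SimpleGraph V} {v : V}

/-- The vertices of a closed walk as a periodic sequence. -/
def cyclicVert (C : G.Walk v v) (i : ℕ) : V := C.getVert (i % C.length)

theorem cyclicVert_of_lt (C : G.Walk v v) {i : ℕ} (hi : i < C.length) :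
    cyclicVert C i = C.getVert i := by
  rw [cyclicVert, Nat.mod_eq_of_lt hi]

theorem cyclicVert_add_length (C : G.Walk v v) (i : ℕ) :
    cyclicVert C (i + C.length) = cyclicVert C i := by
  simp [cyclicVert]

theorem getVert_eq_cyclicVert (C : G.Walk v v) {i : ℕ} (hi : i ≤ C.length) :
    C.getVert i = cyclicVert C i := by
  rcases hi.lt_or_eq with h | rfl
  · exact (cyclicVert_of_lt C h).symm
  · simp [cyclicVert]

theorem adj_cyclicVert_succ {C : G.Walk v v} (hC : C.IsCycle) (i : ℕ) :
    G.Adj (cyclicVert C i) (cyclicVert C (i + 1)) := by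
  have hL := hC.three_le_length
  have hi : i % C.length < C.length := Nat.mod_lt _ (by omega)
  have h := C.adj_getVert_succ hi
  rw [getVert_eq_cyclicVert C hi] at h
  have h2 : cyclicVert C (i + 1) = cyclicVert C (i % C.length + 1) := by
    simp [cyclicVert]
  rw [h2]
  exact h

theorem cyclicVert_inj {C : G.Walk v v} (hC : C.IsCycle) {i j : ℕ}
    (h : cyclicVert C i = cyclicVert C j) : i % C.length = j % C.length := by
  have hL := hC.three_le_length
  have hi : i % C.length < C.length := Nat.mod_lt _ (by omega)
  have hj : j % C.length < C.length := Nat.mod_lt _ (by omega)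
  exact hC.getVert_injOn' (by simp only [Set.mem_ofPred_eq]; omega)
    (by simp only [Set.mem_ofPred_eq]; omega) h

theorem cyclicVert_ne {C : G.Walk v v} (hC : C.IsCycle) {i k : ℕ} (hk : 0 < k)
    (hkL : k < C.length) : cyclicVert C i ≠ cyclicVert C (i + k) := by
  intro h
  have h1 : i ≡ i + k [MOD C.length] := cyclicVert_inj hC h
  have h2 : 0 ≡ k [MOD C.length] := Nat.ModEq.add_left_cancel' i (by simpa using h1)
  have h3 : 0 % C.length = k % C.length := h2
  rw [Nat.zero_mod, Nat.mod_eq_of_lt hkL] at h3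
  omega

theorem isChordAt_of_adj {C : G.Walk v v} (hC : C.IsCycle) {a b : ℕ} (hab : a + 2 ≤ b)
    (hb : b < C.length) (hba : b + 2 ≤ a + C.length)
    (h : G.Adj (C.getVert a) (C.getVert b)) : IsChordAt C a b := by
  refine ⟨by omega, hb, h, fun hmem => ?_⟩
  obtain ⟨k, hkL, hk⟩ := (Walk.mk_mem_edges_iff_exists C).1 hmem
  have inj : ∀ {m n : ℕ}, m < C.length → n < C.length → C.getVert m = C.getVert n → m = n :=
    fun hm hn hmn => hC.getVert_injOn' (by simp only [Set.mem_ofPred_eq]; omega)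
      (by simp only [Set.mem_ofPred_eq]; omega) hmn
  -- Position `k + 1` may equal `C.length`, where the closed walk is back at position 0.
  have key : ∀ {n : ℕ}, n < C.length → C.getVert (k + 1) = C.getVert n →
      n = k + 1 ∨ (n = 0 ∧ k + 1 = C.length) := by
    intro n hn hkn
    rcases Nat.lt_or_ge (k + 1) C.length with h1 | h1
    · exact Or.inl (inj h1 hn hkn).symm
    · have h2 : k + 1 = C.length := by omega
      refine Or.inr ⟨?_, h2⟩
      rw [h2, Walk.getVert_length] at hkn
      exact inj hn (by omega) (by rw [← hkn, Walk.getVert_zero])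
  rcases Sym2.eq_iff.1 hk with ⟨h1, h2⟩ | ⟨h1, h2⟩
  · have := inj hkL (by omega) h1
    rcases key hb h2 with h3 | h3 <;> omega
  · have := inj hkL (by omega) h1
    rcases key (by omega) h2 with h3 | h3 <;> omega

/-- If the `k` steps pass the base point, the chord's positions differ by `C.length - k` instead,
which has the parity of `k` when the length is even. -/
theorem exists_isChordAt {C : G.Walk v v} (hC : C.IsCycle) {i k : ℕ} (hk : 2 ≤ k)
    (hkL : k + 2 ≤ C.length) (h : G.Adj (cyclicVert C i) (cyclicVert C (i + k))) :
    ∃ a b, IsChordAt C a b ∧ (Even C.length → Odd k → Odd (b - a)) := by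
  set r := i % C.length with hr
  have hrL : r < C.length := Nat.mod_lt _ (by omega)
  have e1 : cyclicVert C i = cyclicVert C r := by simp [cyclicVert, hr]
  have e2 : cyclicVert C (i + k) = cyclicVert C (r + k) := by simp [cyclicVert, hr]
  rw [e1, e2] at h
  rcases Nat.lt_or_ge (r + k) C.length with h1 | h1
  · refine ⟨r, r + k, isChordAt_of_adj hC (by omega) h1 (by omega) ?_, fun _ ho => ?_⟩
    · rwa [cyclicVert_of_lt C hrL, cyclicVert_of_lt C h1] at h
    · rwa [Nat.add_sub_cancel_left]
  · obtain ⟨s, hs⟩ := Nat.exists_eq_add_of_le' h1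
    have hsL : s < C.length := by omega
    rw [hs, cyclicVert_add_length, cyclicVert_of_lt C hrL, cyclicVert_of_lt C hsL] at h
    refine ⟨s, r, isChordAt_of_adj hC (by omega) hrL (by omega) h.symm, fun he ho => ?_⟩
    have : r - s = C.length - k := by omega
    rw [this]
    exact Nat.Even.sub_odd (by omega) he ho

/-- Split graphs are chordal. -/
theorem isChordal_of_isClique_of_isIndepSet {K : Set V} (hK : G.IsClique K)
    (hI : G.IsIndepSet Kᶜ) : IsChordal G := by
  intro v C hC hL
  have hadj := adj_cyclicVert_succ hC
  have hI' : ∀ i, cyclicVert C i ∈ K ∨ cyclicVert C (i + 1) ∈ K := by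
    intro i
    by_contra! hcon
    exact hI hcon.1 hcon.2 (hadj i).ne (hadj i)
  have hchord : ∀ i, cyclicVert C i ∈ K → cyclicVert C (i + 2) ∈ K → HasChord C := by
    intro i h0 h2
    obtain ⟨a, b, hab, -⟩ := exists_isChordAt hC (i := i) le_rfl hL
      (hK h0 h2 (cyclicVert_ne hC (by omega) (by omega)))
    exact ⟨a, b, hab⟩
  -- No two consecutive positions avoid `K`, so one of the pairs (1, 3), (2, 4), (0, 2) lies in `K`.
  by_cases h1 : cyclicVert C 1 ∈ K
  · by_cases h3 : cyclicVert C 3 ∈ K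
    · exact hchord 1 h1 h3
    · exact hchord 2 ((hI' 2).resolve_right h3) ((hI' 3).resolve_left h3)
  · exact hchord 0 ((hI' 0).resolve_right h1) ((hI' 1).resolve_left h1)

/-- Two consecutive clique vertices on an even cycle of a split graph force an odd chord. -/
theorem hasOddChord_of_consecutive {K : Set V} (hK : G.IsClique K) (hI : G.IsIndepSet Kᶜ)
    {C : G.Walk v v} (hC : C.IsCycle) (he : Even C.length) (hL : 6 ≤ C.length) {i : ℕ}
    (h0 : cyclicVert C i ∈ K) (h1 : cyclicVert C (i + 1) ∈ K) : HasOddChord C := by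
  have hchord : ∀ j, cyclicVert C j ∈ K → cyclicVert C (j + 3) ∈ K → HasOddChord C := by
    intro j hj hj3
    obtain ⟨a, b, hab, ho⟩ := exists_isChordAt hC (i := j) (k := 3) (by omega) (by omega)
      (hK hj hj3 (cyclicVert_ne hC (by omega) (by omega)))
    exact ⟨a, b, hab, ho he (by decide)⟩
  by_cases h3 : cyclicVert C (i + 3) ∈ K
  · exact hchord i h0 h3
  · refine hchord (i + 1) h1 ?_
    by_contra h4
    have hadj := adj_cyclicVert_succ hC (i + 3)
    exact hI h3 h4 hadj.ne hadj

end Cycles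

/-! ### Lower bounds on mim-width -/

section MimWidth

variable {V : Type*}

theorem mimValue_compl (G : SimpleGraph V) (A : Set V) : mimValue G Aᶜ = mimValue G A := by
  unfold mimValue
  rw [compl_compl, between_comm]

/-- Edges of `G` within one side of the cut are absent from `G.between A Aᶜ`, so only adjacencies
between some `p e` and some `q e'` need control. -/
theorem card_le_mimValue [Finite V] {ι : Type*} (G : SimpleGraph V) (A : Set V) (I : Finset ι)
    (p q : ι → V) (hp : ∀ e ∈ I, p e ∈ A) (hq : ∀ e ∈ I, q e ∉ A)
    (hadj : ∀ e ∈ I, ∀ e' ∈ I, G.Adj (p e) (q e') ↔ e = e') : #I ≤ mimValue G A := by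
  have hbdd : BddAbove {k | ∃ M : (G.between A Aᶜ).Subgraph,
      M.IsMatching ∧ M.IsInduced ∧ M.edgeSet.ncard = k} := by
    refine ⟨Nat.card (Sym2 V), ?_⟩
    rintro k ⟨M, -, -, rfl⟩
    exact Set.ncard_le_card _
  let M : (G.between A Aᶜ).Subgraph :=
    (⊤ : (G.between A Aᶜ).Subgraph).induce (p '' I ∪ q '' I)
  have hpq : ∀ e ∈ I, ∀ e' ∈ I, (G.between A Aᶜ).Adj (p e) (q e') ↔ e = e' := by
    intro e he e' he'
    rw [between_adj, ← hadj e he e' he']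
    exact and_iff_left (Or.inl ⟨hp e he, hq e' he'⟩)
  have hpp : ∀ e ∈ I, ∀ e' ∈ I, ¬ (G.between A Aᶜ).Adj (p e) (p e') := by
    intro e he e' he' h
    rcases (between_adj.1 h).2 with h | h
    · exact h.2 (hp e' he')
    · exact h.1 (hp e he)
  have hqq : ∀ e ∈ I, ∀ e' ∈ I, ¬ (G.between A Aᶜ).Adj (q e) (q e') := by
    intro e he e' he' h
    rcases (between_adj.1 h).2 with h | h
    · exact hq e he h.1
    · exact hq e' he' h.2
  have hM : ∀ {a b}, M.Adj a b ↔
      a ∈ p '' I ∪ q '' I ∧ b ∈ p '' I ∪ q '' I ∧ (G.between A Aᶜ).Adj a b := by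
    intro a b
    simp [M]
  have hMpq : ∀ e ∈ I, M.Adj (p e) (q e) := fun e he =>
    hM.2 ⟨Or.inl ⟨e, he, rfl⟩, Or.inr ⟨e, he, rfl⟩, (hpq e he e he).2 rfl⟩
  have hmatch : M.IsMatching := by
    rintro v (⟨e, he, rfl⟩ | ⟨e, he, rfl⟩)
    · refine ⟨q e, hMpq e he, fun w hw => ?_⟩
      obtain ⟨-, ⟨e', he', rfl⟩ | ⟨e', he', rfl⟩, h⟩ := hM.1 hw
      · exact absurd h (hpp e he e' he')
      · rw [(hpq e he e' he').1 h]
    · refine ⟨p e, (hMpq e he).symm, fun w hw => ?_⟩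
      obtain ⟨-, ⟨e', he', rfl⟩ | ⟨e', he', rfl⟩, h⟩ := hM.1 hw
      · rw [(hpq e' he' e he).1 h.symm]
      · exact absurd h (hqq e he e' he')
  have hind : M.IsInduced := fun a ha b hb h => hM.2 ⟨ha, hb, h⟩
  refine le_trans ?_ (le_csSup hbdd ⟨M, hmatch, hind, rfl⟩)
  rw [← Set.ncard_coe_finset]
  refine Set.ncard_le_ncard_of_injOn (fun e => s(p e, q e)) (fun e he => hMpq e he) ?_
    (Set.toFinite _)
  intro e he e' he' h
  rcases Sym2.eq_iff.1 h with ⟨-, h2⟩ | ⟨h1, -⟩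
  · exact (hpq e he e' he').1 (h2 ▸ (hpq e he e he).2 rfl)
  · exact absurd (hp e he) (h1 ▸ hq e' he')

theorem mimValue_le_treeMimWidth (G : SimpleGraph V) {T S : LeafTree V} (hS : S ∈ T.subtrees) :
    mimValue G {v | v ∈ S.leaves} ≤ treeMimWidth G T := by
  refine le_csSup (Set.Finite.bddAbove ?_) ⟨S, hS, rfl⟩
  refine ((List.finite_toSet T.subtrees).image
    fun S : LeafTree V => mimValue G {v | v ∈ S.leaves}).subset ?_
  rintro k ⟨S, hS, rfl⟩
  exact ⟨S, hS, rfl⟩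

theorem LeafTree.exists_leaves_eq : ∀ (l : List V), l ≠ [] → ∃ T : LeafTree V, T.leaves = l
  | [], h => absurd rfl h
  | [a], _ => ⟨.leaf a, rfl⟩
  | a :: b :: l, _ => by
    obtain ⟨T, hT⟩ := exists_leaves_eq (b :: l) (by simp)
    exact ⟨.node (.leaf a) T, by simp [LeafTree.leaves, hT]⟩

theorem le_mimWidth [Finite V] [Nonempty V] (G : SimpleGraph V) (k : ℕ)
    (h : ∀ T : LeafTree V, T.IsBranchDecomposition →
      ∃ S ∈ T.subtrees, k ≤ mimValue G {v | v ∈ S.leaves}) : k ≤ mimWidth G := by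
  -- As `sInf ∅ = 0` in `ℕ`, some branch decomposition must be exhibited; a caterpillar does.
  have hne : {k | ∃ T : LeafTree V, T.IsBranchDecomposition ∧ treeMimWidth G T = k}.Nonempty := by
    have := Fintype.ofFinite V
    obtain ⟨T, hT⟩ := LeafTree.exists_leaves_eq (univ : Finset V).toList
      (by simp [univ_nonempty.ne_empty])
    exact ⟨_, T, ⟨by rw [hT]; exact nodup_toList _, by simp [hT]⟩, rfl⟩
  refine le_csInf hne ?_
  rintro m ⟨T, hT, rfl⟩
  obtain ⟨S, hS, hk⟩ := h T hT
  exact hk.trans (mimValue_le_treeMimWidth G hS)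

theorem LeafTree.sublist_leaves {S : LeafTree V} :
    ∀ {T : LeafTree V}, S ∈ T.subtrees → S.leaves.Sublist T.leaves
  | .leaf a, h => by
    rw [List.mem_singleton.1 h]
  | .node l r, h => by
    rcases List.mem_cons.1 h with rfl | h
    · exact List.Sublist.refl _
    · rcases List.mem_append.1 h with h | h
      · exact (sublist_leaves h).trans (List.sublist_append_left _ _)
      · exact (sublist_leaves h).trans (List.sublist_append_right _ _)

theorem LeafTree.self_mem_subtrees (T : LeafTree V) : T ∈ T.subtrees := by
  cases T <;> simp [subtrees]

/-- Some subtree carries a balanced share of the leaves satisfying `P`. -/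
theorem LeafTree.exists_balanced (P : V → Bool) {k : ℕ} (hk : 0 < k) :
    ∀ T : LeafTree V, 2 * k < T.leaves.countP P →
      ∃ S ∈ T.subtrees, k ≤ S.leaves.countP P ∧ S.leaves.countP P ≤ 2 * k
  | .leaf a, h => by
    have : [a].countP P ≤ 1 := List.countP_le_length
    simp only [leaves] at h
    omega
  | .node l r, h => by
    simp only [leaves, List.countP_append] at h
    have hl : ∀ S ∈ l.subtrees, S ∈ (node l r).subtrees := fun S hS => by simp [subtrees, hS]
    have hr : ∀ S ∈ r.subtrees, S ∈ (node l r).subtrees := fun S hS => by simp [subtrees, hS]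
    by_cases h1 : 2 * k < l.leaves.countP P
    · obtain ⟨S, hS, hb⟩ := exists_balanced P hk l h1
      exact ⟨S, hl S hS, hb⟩
    by_cases h2 : 2 * k < r.leaves.countP P
    · obtain ⟨S, hS, hb⟩ := exists_balanced P hk r h2
      exact ⟨S, hr S hS, hb⟩
    -- Neither child exceeds `2 * k` but their sum does, so one of them reaches `k`.
    by_cases h3 : k ≤ l.leaves.countP P
    · exact ⟨l, hl l l.self_mem_subtrees, h3, by omega⟩
    · exact ⟨r, hr r r.self_mem_subtrees, by omega, by omega⟩

/-- A branch decomposition has a node whose leaf set splits the image of an injection `f`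
between one third and two thirds. -/
theorem LeafTree.IsBranchDecomposition.exists_balanced {α : Type*} [Fintype α] {f : α → V}
    (hf : Function.Injective f) {T : LeafTree V} (hT : T.IsBranchDecomposition) {k : ℕ}
    (hk : 0 < k) (hα : Fintype.card α = 3 * k) :
    ∃ S ∈ T.subtrees, ∃ P Q : Finset α, k ≤ #P ∧ k ≤ #Q ∧
      (∀ a ∈ P, f a ∈ S.leaves) ∧ ∀ a ∈ Q, f a ∉ S.leaves := by
  classical
  have hcount : ∀ S ∈ T.subtrees, S.leaves.countP (fun v => decide (v ∈ Set.range f)) =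
      #{a | f a ∈ S.leaves} := by
    intro S hS
    have hnd : S.leaves.Nodup := hT.1.sublist (LeafTree.sublist_leaves hS)
    rw [List.countP_eq_length_filter, ← List.toFinset_card_of_nodup (hnd.filter _),
      ← card_image_of_injective _ hf]
    congr 1
    ext v
    simp only [List.mem_toFinset, List.mem_filter, decide_eq_true_eq, mem_image, mem_filter,
      mem_univ, true_and, Set.mem_range]
    constructor
    · rintro ⟨hv, a, rfl⟩
      exact ⟨a, hv, rfl⟩
    · rintro ⟨a, ha, rfl⟩
      exact ⟨ha, a, rfl⟩
  have htot : 2 * k < T.leaves.countP (fun v => decide (v ∈ Set.range f)) := by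
    rw [hcount T T.self_mem_subtrees, filter_true_of_mem fun a _ => hT.2 (f a), card_univ, hα]
    omega
  obtain ⟨S, hS, h1, h2⟩ := LeafTree.exists_balanced _ hk T htot
  rw [hcount S hS] at h1 h2
  have h3 := card_filter_add_card_filter_not (s := (univ : Finset α)) (fun a => f a ∈ S.leaves)
  rw [card_univ, hα] at h3
  exact ⟨S, hS, _, _, h1, (by omega : k ≤ #{a | f a ∉ S.leaves}), by simp, by simp⟩

end MimWidth

/-! ### Sparse bipartite graphs with edges between all large sets -/

section Expander

/-- The bipartite multigraph with edges `e`, joining `l e` to `r e`, has an edge between any two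
sets of size `N`. -/
def Joins {α β ι : Type*} (l : ι → α) (r : ι → β) (N : ℕ) : Prop :=
  ∀ (S : Finset α) (T : Finset β), N ≤ #S → N ≤ #T → ∃ e, l e ∈ S ∧ r e ∈ T

/-- Union bound: a uniformly random `F` fails for a fixed pair of `N`-sets with probability `(5/6) ^
(48 * N)`, and there are at most `4 ^ (6 * N)` pairs. -/
theorem exists_joins {N : ℕ} (hN : 0 < N) :
    ∃ F : Fin (6 * N) × Fin 48 → Fin (6 * N), Joins Prod.fst F N := by
  classical
  -- The maps that send no edge starting in `p.1` into `p.2`.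
  let bad (p : Finset (Fin (6 * N)) × Finset (Fin (6 * N))) :
      Finset (Fin (6 * N) × Fin 48 → Fin (6 * N)) :=
    Fintype.piFinset fun e => if e.1 ∈ p.1 then p.2ᶜ else univ
  let pairs := powersetCard N (univ : Finset (Fin (6 * N))) ×ˢ
    powersetCard N (univ : Finset (Fin (6 * N)))
  have hbad : ∀ p ∈ pairs, #(bad p) = (5 * N) ^ (48 * N) * (6 * N) ^ (48 * (5 * N)) := by
    rintro ⟨S, T⟩ hp
    obtain ⟨hS, hT⟩ := mem_product.1 hp
    have hS := (mem_powersetCard.1 hS).2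
    have hT := (mem_powersetCard.1 hT).2
    have hSc : #Sᶜ = 5 * N := by rw [card_compl, Fintype.card_fin, hS]; omega
    have hTc : #Tᶜ = 5 * N := by rw [card_compl, Fintype.card_fin, hT]; omega
    let g (a : Fin (6 * N)) : ℕ := if a ∈ S then 5 * N else 6 * N
    have hfac : ∀ e : Fin (6 * N) × Fin 48, #(if e.1 ∈ S then Tᶜ else univ) =
        g e.1 := by
      intro e
      simp only [g]
      split_ifs
      · exact hTc
      · rw [card_univ, Fintype.card_fin]
    rw [Fintype.card_piFinset, prod_congr rfl fun e _ => hfac e, Fintype.prod_prod_type]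
    change ∏ a, ∏ _ : Fin 48, g a = _
    simp only [prod_const, card_univ, Fintype.card_fin]
    rw [prod_pow, ← prod_mul_prod_compl S,
      prod_congr rfl (g := fun _ => 5 * N) (fun a ha => if_pos ha),
      prod_congr rfl (s₁ := Sᶜ) (g := fun _ => 6 * N) (fun a ha => if_neg (mem_compl.1 ha)),
      prod_const, prod_const, hS, hSc, mul_pow _ _ 48, ← pow_mul, ← pow_mul, mul_comm N,
      mul_comm (5 * N) 48]
  have hpairs : #pairs ≤ 4 ^ (6 * N) := by
    rw [card_product, card_powersetCard, card_univ, Fintype.card_fin]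
    calc _ ≤ 2 ^ (6 * N) * 2 ^ (6 * N) :=
          Nat.mul_le_mul (Nat.choose_le_two_pow _ _) (Nat.choose_le_two_pow _ _)
      _ = 4 ^ (6 * N) := by rw [← mul_pow]; norm_num
  have hlt : #(pairs.biUnion bad) < #(univ : Finset (Fin (6 * N) × Fin 48 → Fin (6 * N))) := by
    calc #(pairs.biUnion bad)
        ≤ #pairs * ((5 * N) ^ (48 * N) * (6 * N) ^ (48 * (5 * N))) :=
          card_biUnion_le_card_mul _ _ _ fun p hp => (hbad p hp).le
      _ ≤ 4 ^ (6 * N) * ((5 * N) ^ (48 * N) * (6 * N) ^ (48 * (5 * N))) :=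
          Nat.mul_le_mul_right _ hpairs
      _ = (4 ^ 6 * 5 ^ 48) ^ N * (N ^ (48 * N) * (6 * N) ^ (48 * (5 * N))) := by
          rw [mul_pow 5 N, mul_pow (4 ^ 6), ← pow_mul, ← pow_mul]
          ring
      -- The degree 48 is large enough that `4 ^ 6 * 5 ^ 48 < 6 ^ 48`.
      _ < (6 ^ 48) ^ N * (N ^ (48 * N) * (6 * N) ^ (48 * (5 * N))) := by
          refine Nat.mul_lt_mul_of_pos_right (Nat.pow_lt_pow_left (by norm_num) hN.ne') ?_
          positivity
      _ = (6 * N) ^ (48 * N + 48 * (5 * N)) := by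
          rw [pow_add, mul_pow 6 N (48 * N), ← pow_mul]
          ring
      _ = #(univ : Finset (Fin (6 * N) × Fin 48 → Fin (6 * N))) := by
          rw [card_univ, Fintype.card_fun, Fintype.card_prod, Fintype.card_fin, Fintype.card_fin]
          congr 1
          ring
  obtain ⟨F, -, hF⟩ := exists_mem_notMem_of_card_lt_card hlt
  refine ⟨F, fun S T hS hT => ?_⟩
  obtain ⟨S', hS', hS'c⟩ := exists_subset_card_eq hS
  obtain ⟨T', hT', hT'c⟩ := exists_subset_card_eq hT
  by_contra! hcon
  refine hF (mem_biUnion.2 ⟨(S', T'), ?_, ?_⟩)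
  · simp [pairs, mem_powersetCard, hS'c, hT'c]
  · refine Fintype.mem_piFinset.2 fun e => ?_
    split_ifs with he
    · exact mem_compl.2 fun h => hcon e (hS' he) (hT' h)
    · exact mem_univ _

/-- Greedily, sets of size `2 * N` are joined by a matching of size `N`. -/
theorem Joins.exists_matching {α β ι : Type*} {l : ι → α} {r : ι → β} {N : ℕ}
    (h : Joins l r N) {P : Finset α} {Q : Finset β} (hP : 2 * N ≤ #P) (hQ : 2 * N ≤ #Q) :
    ∀ k ≤ N, ∃ M : Finset ι, #M = k ∧ (∀ e ∈ M, l e ∈ P ∧ r e ∈ Q) ∧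
      Set.InjOn l M ∧ Set.InjOn r M := by
  classical
  intro k
  induction k with
  | zero => exact fun _ => ⟨∅, by simp⟩
  | succ k ih =>
    intro hk
    obtain ⟨M, hMk, hM, hl, hr⟩ := ih (by omega)
    have h1 := le_card_sdiff (M.image l) P
    have h2 := le_card_sdiff (M.image r) Q
    have h3 : #(M.image l) ≤ #M := card_image_le
    have h4 : #(M.image r) ≤ #M := card_image_le
    -- The `k < N` edges chosen so far leave more than `N` unused vertices on each side.
    obtain ⟨e, hel, her⟩ := h (P \ M.image l) (Q \ M.image r) (by omega) (by omega)
    rw [mem_sdiff] at hel her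
    have heM : e ∉ M := fun he => hel.2 (mem_image_of_mem l he)
    refine ⟨insert e M, by rw [card_insert_of_notMem heM, hMk], ?_, ?_, ?_⟩
    · intro e' he'
      rcases mem_insert.1 he' with rfl | he'
      · exact ⟨hel.1, her.1⟩
      · exact hM e' he'
    · rw [coe_insert, Set.injOn_insert (by simpa using heM)]
      exact ⟨hl, by simpa using hel.2⟩
    · rw [coe_insert, Set.injOn_insert (by simpa using heM)]
      exact ⟨hr, by simpa using her.2⟩

end Expander

/-! ### The chordal bipartite graph of a bipartite multigraph -/

/-- The vertices of a bipartite multigraph with classes `α`, `β` and edges `ι`, together with two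
subdivision vertices on every edge. -/
inductive SubdivVertex (α β ι : Type*) where
  | left (a : α)
  | right (b : β)
  | nearLeft (e : ι)
  | nearRight (e : ι)

namespace SubdivVertex

variable {α β ι : Type*}

/-- The four kinds of vertices as a sum type. -/
def equivSum : SubdivVertex α β ι ≃ (α ⊕ β) ⊕ (ι ⊕ ι) where
  toFun
    | left a => .inl (.inl a)
    | right b => .inl (.inr b)
    | nearLeft e => .inr (.inl e)
    | nearRight e => .inr (.inr e)
  invFun
    | .inl (.inl a) => left a
    | .inl (.inr b) => right b
    | .inr (.inl e) => nearLeft e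
    | .inr (.inr e) => nearRight e
  left_inv v := by cases v <;> rfl
  right_inv v := by rcases v with (_ | _) | (_ | _) <;> rfl

instance [Fintype α] [Fintype β] [Fintype ι] : Fintype (SubdivVertex α β ι) :=
  Fintype.ofEquiv _ equivSum.symm

theorem card_eq [Fintype α] [Fintype β] [Fintype ι] :
    Fintype.card (SubdivVertex α β ι) =
      Fintype.card α + Fintype.card β + 2 * Fintype.card ι := by
  rw [Fintype.card_congr equivSum]
  simp only [Fintype.card_sum]
  ring

/-- The colour class of the left vertices. -/
def leftClass : Set (SubdivVertex α β ι)
  | left _ => True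
  | nearRight _ => True
  | _ => False

@[simp] theorem left_mem (a : α) : (left a : SubdivVertex α β ι) ∈ leftClass := trivial

@[simp] theorem nearRight_mem (e : ι) : (nearRight e : SubdivVertex α β ι) ∈ leftClass := trivial

@[simp] theorem right_notMem (b : β) : (right b : SubdivVertex α β ι) ∉ leftClass := id

@[simp] theorem nearLeft_notMem (e : ι) : (nearLeft e : SubdivVertex α β ι) ∉ leftClass := id

end SubdivVertex

open SubdivVertex

variable {α β ι : Type*}

/-- Subdivide every edge of the bipartite multigraph given by `l` and `r` twice and join all left
vertices to all right vertices. -/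
def filledSubdivision (l : ι → α) (r : ι → β) : SimpleGraph (SubdivVertex α β ι) where
  Adj
    | left _, right _ => True
    | right _, left _ => True
    | left a, nearLeft e => l e = a
    | nearLeft e, left a => l e = a
    | nearLeft e, nearRight e' => e = e'
    | nearRight e, nearLeft e' => e = e'
    | nearRight e, right b => r e = b
    | right b, nearRight e => r e = b
    | _, _ => False
  symm := ⟨fun a b h => by cases a <;> cases b <;> simp_all⟩
  loopless := ⟨fun a h => by cases a <;> exact h⟩

section

variable (l : ι → α) (r : ι → β)

theorem filledSubdivision_isBipartiteWith :
    (filledSubdivision l r).IsBipartiteWith leftClassᶜ leftClass where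
  disjoint := disjoint_compl_left
  mem_of_adj a b h := by
    cases a <;> cases b <;> simp_all [filledSubdivision]

theorem filledSubdivision_adj_nearLeft {e : ι} {v : SubdivVertex α β ι} :
    (filledSubdivision l r).Adj (nearLeft e) v ↔ v = left (l e) ∨ v = nearRight e := by
  cases v <;> simp [filledSubdivision, eq_comm]

theorem filledSubdivision_adj_nearRight {e : ι} {v : SubdivVertex α β ι} :
    (filledSubdivision l r).Adj (nearRight e) v ↔ v = right (r e) ∨ v = nearLeft e := by
  cases v <;> simp [filledSubdivision, eq_comm]

theorem filledSubdivision_adj_left_right (a : α) (b : β) :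
    (filledSubdivision l r).Adj (left a) (right b) := trivial

/-- Around a subdivision vertex, a sequence of consecutively adjacent vertices without immediate
returns traverses a whole subdivided edge, whose ends are adjacent. -/
theorem filledSubdivision_adj_or_adj {a b c d f : SubdivVertex α β ι} {e : ι}
    (hc : c = nearLeft e ∨ c = nearRight e) (hab : (filledSubdivision l r).Adj a b)
    (hbc : (filledSubdivision l r).Adj b c) (hcd : (filledSubdivision l r).Adj c d)
    (hdf : (filledSubdivision l r).Adj d f) (hac : a ≠ c) (hbd : b ≠ d) (hcf : c ≠ f) :
    (filledSubdivision l r).Adj a d ∨ (filledSubdivision l r).Adj b f := by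
  have hlr := filledSubdivision_adj_left_right l r (l e) (r e)
  replace hab := hab.symm
  replace hbc := hbc.symm
  rcases hc with rfl | rfl
  -- The distinct neighbours `b` and `d` of `c` are its original end and its twin; beyond the twin,
  -- the sequence can only go on to the opposite end.
  · rw [filledSubdivision_adj_nearLeft] at hbc hcd
    rcases hbc with rfl | rfl <;> rcases hcd with rfl | rfl
    · exact absurd rfl hbd
    · rcases (filledSubdivision_adj_nearRight l r).1 hdf with rfl | rfl
      · exact Or.inr hlr
      · exact absurd rfl hcf
    · rcases (filledSubdivision_adj_nearRight l r).1 hab with rfl | rfl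
      · exact Or.inl hlr.symm
      · exact absurd rfl hac
    · exact absurd rfl hbd
  · rw [filledSubdivision_adj_nearRight] at hbc hcd
    rcases hbc with rfl | rfl <;> rcases hcd with rfl | rfl
    · exact absurd rfl hbd
    · rcases (filledSubdivision_adj_nearLeft l r).1 hdf with rfl | rfl
      · exact Or.inr hlr.symm
      · exact absurd rfl hcf
    · rcases (filledSubdivision_adj_nearLeft l r).1 hab with rfl | rfl
      · exact Or.inl hlr
      · exact absurd rfl hac
    · exact absurd rfl hbd

/-- A sequence of consecutively adjacent vertices without immediate returns has two adjacent
members three steps apart. -/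
theorem filledSubdivision_exists_adj_add_three {f : ℕ → SubdivVertex α β ι}
    (hf : ∀ i, (filledSubdivision l r).Adj (f i) (f (i + 1))) (hne : ∀ i, f i ≠ f (i + 2)) :
    ∃ i, (filledSubdivision l r).Adj (f i) (f (i + 3)) := by
  -- The shift by 2 gives the subdivision vertex two predecessors in the sequence.
  by_cases hsub : ∃ i e, f (i + 2) = nearLeft e ∨ f (i + 2) = nearRight e
  · obtain ⟨i, e, h⟩ := hsub
    rcases filledSubdivision_adj_or_adj l r h (hf i) (hf (i + 1)) (hf (i + 2)) (hf (i + 3))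
      (hne i) (hne (i + 1)) (hne (i + 2)) with h | h
    · exact ⟨i, h⟩
    · exact ⟨i + 1, h⟩
  -- From position 2 on, the sequence alternates between original left and right vertices, so
  -- positions 2 and 5 are adjacent.
  · have hmain : ∀ i, (∃ a, f (i + 2) = left a) ∨ ∃ b, f (i + 2) = right b := by
      intro i
      cases h : f (i + 2) with
      | left a => exact Or.inl ⟨a, rfl⟩
      | right b => exact Or.inr ⟨b, rfl⟩
      | nearLeft e => exact absurd ⟨i, e, Or.inl h⟩ hsub
      | nearRight e => exact absurd ⟨i, e, Or.inr h⟩ hsub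
    have hleft : ∀ i a, f (i + 2) = left a → ∃ b, f (i + 3) = right b := by
      intro i a h
      refine (hmain (i + 1)).resolve_left ?_
      rintro ⟨a', h'⟩
      have := hf (i + 2)
      rw [h, h'] at this
      exact this
    have hright : ∀ i b, f (i + 2) = right b → ∃ a, f (i + 3) = left a := by
      intro i b h
      refine (hmain (i + 1)).resolve_right ?_
      rintro ⟨b', h'⟩
      have := hf (i + 2)
      rw [h, h'] at this
      exact this
    rcases hmain 0 with ⟨a, h2⟩ | ⟨b, h2⟩
    · obtain ⟨b, h3⟩ := hleft 0 a h2
      obtain ⟨a', h4⟩ := hright 1 b h3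
      obtain ⟨b', h5⟩ := hleft 2 a' h4
      exact ⟨2, by rw [h2, h5]; trivial⟩
    · obtain ⟨a, h3⟩ := hright 0 b h2
      obtain ⟨b', h4⟩ := hleft 1 a h3
      obtain ⟨a', h5⟩ := hright 2 b' h4
      exact ⟨2, by rw [h2, h5]; trivial⟩

theorem filledSubdivision_isChordalBipartite : IsChordalBipartite (filledSubdivision l r) := by
  refine ⟨(filledSubdivision_isBipartiteWith l r).isBipartite, fun v C hC hL => ?_⟩
  obtain ⟨i, hi⟩ := filledSubdivision_exists_adj_add_three l r (adj_cyclicVert_succ hC)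
    (fun i => cyclicVert_ne hC (by omega) (by omega))
  obtain ⟨a, b, hab, -⟩ := exists_isChordAt hC (by omega) (by omega) hi
  exact ⟨a, b, hab⟩

/-- The split graph obtained by turning the left colour class into a clique. -/
def splitSubdivision : SimpleGraph (SubdivVertex α β ι) :=
  makeClique (filledSubdivision l r) leftClass

theorem splitSubdivision_adj {a b : SubdivVertex α β ι} : (splitSubdivision l r).Adj a b ↔
    (filledSubdivision l r).Adj a b ∨ a ≠ b ∧ a ∈ leftClass ∧ b ∈ leftClass := by
  simp only [splitSubdivision, makeClique, sup_adj, fromRel_adj]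
  tauto

theorem filledSubdivision_le_splitSubdivision : filledSubdivision l r ≤ splitSubdivision l r :=
  le_sup_left

theorem splitSubdivision_adj_of_notMem {a b : SubdivVertex α β ι}
    (h : a ∉ leftClass ∨ b ∉ leftClass) :
    (splitSubdivision l r).Adj a b ↔ (filledSubdivision l r).Adj a b := by
  rw [splitSubdivision_adj]
  tauto

theorem splitSubdivision_isClique : (splitSubdivision l r).IsClique leftClass :=
  fun _ ha _ hb hne => (splitSubdivision_adj l r).2 (Or.inr ⟨hne, ha, hb⟩)

theorem splitSubdivision_isIndepSet : (splitSubdivision l r).IsIndepSet leftClassᶜ := by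
  intro a ha b hb _ h
  rw [splitSubdivision_adj_of_notMem l r (Or.inl ha)] at h
  rcases (filledSubdivision_isBipartiteWith l r).mem_of_adj h with h | h
  · exact hb h.2
  · exact ha h.1

/-- An even cycle without consecutive clique vertices uses only edges of `filledSubdivision l r`,
where a chord spanning three steps exists. -/
theorem splitSubdivision_isStronglyChordal : IsStronglyChordal (splitSubdivision l r) := by
  have hK := splitSubdivision_isClique l r
  have hI := splitSubdivision_isIndepSet l r
  refine ⟨isChordal_of_isClique_of_isIndepSet hK hI, fun v C hC he hL => ?_⟩
  by_cases hcons : ∃ i, cyclicVert C i ∈ leftClass ∧ cyclicVert C (i + 1) ∈ leftClass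
  · obtain ⟨i, h0, h1⟩ := hcons
    exact hasOddChord_of_consecutive hK hI hC he hL h0 h1
  · have hadj : ∀ i, (filledSubdivision l r).Adj (cyclicVert C i) (cyclicVert C (i + 1)) :=
      fun i => (splitSubdivision_adj_of_notMem l r
        (not_and_or.1 fun h => hcons ⟨i, h⟩)).1 (adj_cyclicVert_succ hC i)
    obtain ⟨i, hi⟩ := filledSubdivision_exists_adj_add_three l r hadj
      (fun i => cyclicVert_ne hC (by omega) (by omega))
    obtain ⟨a, b, hab, ho⟩ := exists_isChordAt hC (by omega) (by omega)
      (filledSubdivision_le_splitSubdivision l r hi)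
    exact ⟨a, b, hab, ho he (by decide)⟩

end

/-! ### Linear mim-width of filled subdivisions and their split versions. -/

section LowerBound

variable [Finite α] [Finite β] [Finite ι] {l : ι → α} {r : ι → β}
  {G : SimpleGraph (SubdivVertex α β ι)}

instance : Finite (SubdivVertex α β ι) := Finite.of_equiv _ equivSum.symm

/-- Each of the `3 * k` matched paths leaves `A` at its first, second or third edge, so some
position occurs `k` times. Edges at equal positions of different paths are not linked across the
cut, because the matching is injective at both ends. One endpoint of each lies outside `leftClass`,
so `hG` lets the argument cover both graphs. -/
theorem le_mimValue_of_joins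
    (hG : ∀ a b, a ∉ leftClass ∨ b ∉ leftClass →
      (G.Adj a b ↔ (filledSubdivision l r).Adj a b))
    {k : ℕ} (hJ : Joins l r (3 * k)) {A : Set (SubdivVertex α β ι)} {P : Finset α} {Q : Finset β}
    (hP : 2 * (3 * k) ≤ #P) (hQ : 2 * (3 * k) ≤ #Q) (hPA : ∀ a ∈ P, left a ∈ A)
    (hQA : ∀ b ∈ Q, right b ∉ A) : k ≤ mimValue G A := by
  classical
  obtain ⟨M, hMk, hM, hl, hr⟩ := hJ.exists_matching hP hQ _ le_rfl
  have h1 : #{e ∈ M | nearLeft e ∉ A} ≤ mimValue G A := by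
    refine card_le_mimValue G A _ (fun e => left (l e)) nearLeft ?_ ?_ ?_
    · exact fun e he => hPA _ (hM e (mem_filter.1 he).1).1
    · exact fun e he => (mem_filter.1 he).2
    · intro e he e' he'
      rw [hG _ _ (Or.inr (nearLeft_notMem _))]
      exact ⟨fun h => (hl (mem_filter.1 he').1 (mem_filter.1 he).1 h).symm, fun h => h ▸ rfl⟩
  have h2 : #{e ∈ M | nearLeft e ∈ A ∧ nearRight e ∉ A} ≤ mimValue G A := by
    refine card_le_mimValue G A _ nearLeft nearRight ?_ ?_ ?_
    · exact fun e he => (mem_filter.1 he).2.1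
    · exact fun e he => (mem_filter.1 he).2.2
    · intro e he e' he'
      rw [hG _ _ (Or.inl (nearLeft_notMem _))]
      exact Iff.rfl
  have h3 : #{e ∈ M | nearRight e ∈ A} ≤ mimValue G A := by
    refine card_le_mimValue G A _ nearRight (fun e => right (r e)) ?_ ?_ ?_
    · exact fun e he => (mem_filter.1 he).2
    · exact fun e he => hQA _ (hM e (mem_filter.1 he).1).2
    · intro e he e' he'
      rw [hG _ _ (Or.inr (right_notMem _))]
      exact ⟨fun h => hr (mem_filter.1 he).1 (mem_filter.1 he').1 h, fun h => h ▸ rfl⟩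
  have hcover : M ⊆ ({e ∈ M | nearLeft e ∉ A} ∪ {e ∈ M | nearLeft e ∈ A ∧ nearRight e ∉ A}) ∪
      {e ∈ M | nearRight e ∈ A} := by
    intro e he
    simp only [mem_union, mem_filter]
    tauto
  have hc := (card_le_card hcover).trans
    ((card_union_le _ _).trans (Nat.add_le_add_right (card_union_le _ _) _))
  omega

end LowerBound

theorem le_mimWidth_of_joins [Fintype α] [Fintype β] [Finite ι] {l : ι → α} {r : ι → β}
    {G : SimpleGraph (SubdivVertex α β ι)}
    (hG : ∀ a b, a ∉ leftClass ∨ b ∉ leftClass →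
      (G.Adj a b ↔ (filledSubdivision l r).Adj a b))
    {k : ℕ} (hk : 0 < k) (hJ : Joins l r (3 * k)) (hα : Fintype.card α = 18 * k)
    (hβ : Fintype.card β = 18 * k) : k ≤ mimWidth G := by
  classical
  have : Nonempty α := Fintype.card_pos_iff.1 (by omega)
  have : Nonempty (SubdivVertex α β ι) := this.map left
  refine le_mimWidth G k fun T hT => ?_
  -- A third of the `18 * k` left vertices is `6 * k = 2 * (3 * k)`, the size needed for the greedy
  -- matching.
  obtain ⟨S, hS, P, Q, hP, hQ, hPS, hQS⟩ := hT.exists_balanced (f := left)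
    (fun a b h => SubdivVertex.left.inj h) (k := 6 * k) (by omega) (by omega)
  refine ⟨S, hS, ?_⟩
  have hsum := card_filter_add_card_filter_not (s := (univ : Finset β))
    (fun b => (right b : SubdivVertex α β ι) ∈ S.leaves)
  rw [card_univ, hβ] at hsum
  -- One side of the cut has enough right vertices, and both sides have enough left ones; if the
  -- right vertices are inside, the sides are swapped.
  rcases Nat.lt_or_ge #{b | (right b : SubdivVertex α β ι) ∈ S.leaves} (2 * (3 * k)) with h | h
  · refine le_mimValue_of_joins hG hJ (P := P)
      (Q := {b | (right b : SubdivVertex α β ι) ∉ S.leaves}) (by omega) (by omega) hPS ?_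
    intro b hb
    exact (mem_filter.1 hb).2
  · rw [← mimValue_compl]
    refine le_mimValue_of_joins hG hJ (P := Q)
      (Q := {b | (right b : SubdivVertex α β ι) ∈ S.leaves}) (by omega) h hQS ?_
    intro b hb hb'
    exact hb' (mem_filter.1 hb).2

end MimWidth

open MimWidth SubdivVertex in
/-- There is an infinite family `G i` of pairwise non-isomorphic finite strongly chordal split
graphs of linear mim-width (hence of unbounded mim-width); `G i` arises from a chordal bipartite
graph `H i` of linear mim-width, with colour classes `(Y i)ᶜ` and `Y i`, by turning `Y i` into a
clique. -/
theorem theorem5 :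
    ∃ (c : ℝ) (V : ℕ → Type) (_ : ∀ i, Fintype (V i))
      (G H : ∀ i, SimpleGraph (V i)) (Y : ∀ i, Set (V i)),
      0 < c ∧
      (∀ i, Nonempty (V i)) ∧
      (∀ i j, i ≠ j → IsEmpty (G i ≃g G j)) ∧
      (∀ i, MimWidth.IsStronglyChordal (G i) ∧ MimWidth.IsSplit (G i)) ∧
      (∀ i, c * (Fintype.card (V i) : ℝ) ≤ (MimWidth.mimWidth (G i) : ℝ)) ∧
      (∀ i, MimWidth.IsChordalBipartite (H i) ∧
        (H i).IsBipartiteWith (Y i)ᶜ (Y i) ∧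
        c * (Fintype.card (V i) : ℝ) ≤ (MimWidth.mimWidth (H i) : ℝ) ∧
        G i = MimWidth.makeClique (H i) (Y i)) ∧
      (∀ k : ℕ, ∃ i, k ≤ MimWidth.mimWidth (G i)) := by
  choose F hF using fun i : ℕ => exists_joins (N := 3 * (i + 1)) (by omega)
  let V : ℕ → Type := fun i => SubdivVertex (Fin (6 * (3 * (i + 1)))) (Fin (6 * (3 * (i + 1))))
    (Fin (6 * (3 * (i + 1))) × Fin 48)
  -- With `k = i + 1` the order is `(18 + 18 + 2 * 48 * 18) * k`. This fixes the constant `c`, and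
  -- distinct orders rule out isomorphisms.
  have hcard : ∀ i, Fintype.card (V i) = 1764 * (i + 1) := by
    intro i
    simp only [V, card_eq, Fintype.card_prod, Fintype.card_fin]
    ring
  have hG : ∀ i, i + 1 ≤ mimWidth (splitSubdivision Prod.fst (F i)) := fun i =>
    le_mimWidth_of_joins (fun a b h => splitSubdivision_adj_of_notMem _ _ h) (by omega) (hF i)
      (by rw [Fintype.card_fin]; ring) (by rw [Fintype.card_fin]; ring)
  have hH : ∀ i, i + 1 ≤ mimWidth (filledSubdivision Prod.fst (F i)) := fun i =>
    le_mimWidth_of_joins (fun a b _ => Iff.rfl) (by omega) (hF i)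
      (by rw [Fintype.card_fin]; ring) (by rw [Fintype.card_fin]; ring)
  have hlin : ∀ i m : ℕ, i + 1 ≤ m → (1 / 1764 : ℝ) * (Fintype.card (V i) : ℝ) ≤ m := by
    intro i m h
    rw [hcard]
    have : ((i + 1 : ℕ) : ℝ) ≤ m := Nat.cast_le.2 h
    push_cast at this ⊢
    linarith
  refine ⟨1 / 1764, V, fun i => inferInstance, fun i => splitSubdivision Prod.fst (F i),
    fun i => filledSubdivision Prod.fst (F i), fun _ => leftClass, by norm_num, ?_, ?_, ?_, ?_,
    ?_, ?_⟩
  · exact fun i => Fintype.card_pos_iff.1 (by rw [hcard]; omega)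
  · refine fun i j hij => ⟨fun e => hij ?_⟩
    have := Fintype.card_congr e.toEquiv
    rw [hcard, hcard] at this
    omega
  · exact fun i => ⟨splitSubdivision_isStronglyChordal _ _, leftClass,
      splitSubdivision_isClique _ _, splitSubdivision_isIndepSet _ _⟩
  · exact fun i => hlin i _ (hG i)
  · exact fun i => ⟨filledSubdivision_isChordalBipartite _ _,
      filledSubdivision_isBipartiteWith _ _, hlin i _ (hH i), rfl⟩
  · exact fun k => ⟨k, (Nat.le_succ k).trans (hG k)⟩
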